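/- For $N\ge 0$ let $\omega_N=\frac{\sqrt{-1}}{2\pi}\partial\bar\partial\log(1+\|z\|^2)$ be the $(1,1)$-form of the Fubini–Study metric of $\mathbb{CP}^N$ in the affine chart $\mathbb C^N\subset\mathbb{CP}^N$, $z\mapsto[1:z]$. Let $\Omega\subset\mathbb C^n\subset\mathbb{CP}^n$ be a connected (nonempty) open set and let $h\colon\Omega\to\mathbb C^m\subset\mathbb{CP}^m$ be a holomorphic mapping that is minimally embedded, i.e. whose image is not contained in any proper projective subspace of $\mathbb{CP}^m$. Suppose that $$n(k+1)+k<m<n(k+2)-\frac{k(k+1)}{2}$$ for some integer $k$. Then for every $d\ge 0$ and every holomorphic mapping $f\colon\Omega\to\mathbb C^d\subset\mathbb{CP}^d$, the form $h^*\omega_m$ is not equal on $\Omega$ to the $1$-modification $\omega_{n,f}=\omega_n+f^*\omega_d$ of the Fubini–Study form induced by $f$. -/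

import Mathlib

noncomputable section

namespace FubiniStudyGap

/-- Affine space `ℂⁿ` with its Euclidean norm. -/
abbrev Aff (n : ℕ) : Type := EuclideanSpace ℂ (Fin n)

/-- Complex-valued (real-multilinear) differential `2`-forms on `ℂⁿ`. -/
abbrev TwoForm (n : ℕ) : Type := Aff n → (Aff n) [⋀^Fin 2]→L[ℝ] ℂ

/-- The Wirtinger derivative `∂u/∂z_j`. -/
def wirtinger {n : ℕ} (j : Fin n) (u : Aff n → ℂ) (z : Aff n) : ℂ :=
  (1 / 2) * (fderiv ℝ u z (EuclideanSpace.single j 1)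
    - Complex.I * fderiv ℝ u z (EuclideanSpace.single j Complex.I))

/-- The Wirtinger derivative `∂u/∂z̄_j`. -/
def wirtingerBar {n : ℕ} (j : Fin n) (u : Aff n → ℂ) (z : Aff n) : ℂ :=
  (1 / 2) * (fderiv ℝ u z (EuclideanSpace.single j 1)
    + Complex.I * fderiv ℝ u z (EuclideanSpace.single j Complex.I))

/-- The covector `dz_j`. -/
def dz {n : ℕ} (j : Fin n) : Aff n →L[ℝ] ℂ :=
  (EuclideanSpace.proj j : Aff n →L[ℂ] ℂ).restrictScalars ℝ

/-- The covector `dz̄_j`. -/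
def dzBar {n : ℕ} (j : Fin n) : Aff n →L[ℝ] ℂ :=
  (Complex.conjCLE : ℂ →L[ℝ] ℂ).comp (dz j)

/-- The wedge product of two covectors, `(α ∧ β)(v, w) = α v * β w - α w * β v`. -/
def wedge {n : ℕ} (α β : Aff n →L[ℝ] ℂ) : (Aff n) [⋀^Fin 2]→L[ℝ] ℂ :=
  ContinuousMultilinearMap.alternatization
    ((ContinuousMultilinearMap.mkPiAlgebra ℝ (Fin 2) ℂ).compContinuousLinearMap ![α, β])

theorem wedge_apply {n : ℕ} (α β : Aff n →L[ℝ] ℂ) (v w : Aff n) :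
    wedge α β ![v, w] = α v * β w - α w * β v := by
  have hu : (Finset.univ : Finset (Equiv.Perm (Fin 2))) = {1, Equiv.swap 0 1} := by decide
  have hne : (1 : Equiv.Perm (Fin 2)) ≠ Equiv.swap 0 1 := by decide
  simp [wedge, ContinuousMultilinearMap.alternatization_apply_apply, Fin.prod_univ_two, hu,
    Finset.sum_pair hne, sub_eq_add_neg]

/-- `∂∂̄u = ∑_{j,k} ∂²u/∂z_j∂z̄_k dz_j ∧ dz̄_k`. -/
def ddbar {n : ℕ} (u : Aff n → ℂ) : TwoForm n := fun z =>
  ∑ j : Fin n, ∑ k : Fin n, wirtinger j (wirtingerBar k u) z • wedge (dz j) (dzBar k)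

/-- The Fubini–Study form `ω_n = (√-1 / 2π) ∂∂̄ log (1 + ‖z‖²)` of `ℂℙⁿ` in the affine chart
`ℂⁿ ⊂ ℂℙⁿ`. -/
def fubiniStudy (n : ℕ) : TwoForm n := fun z =>
  (Complex.I / (2 * (Real.pi : ℂ))) •
    ddbar (fun w : Aff n => ((Real.log (1 + ‖w‖ ^ 2) : ℝ) : ℂ)) z

/-- The pullback `g^*η` of a `2`-form. -/
def pullback {n N : ℕ} (g : Aff n → Aff N) (η : TwoForm N) : TwoForm n := fun z =>
  (η (g z)).compContinuousLinearMap (fderiv ℝ g z)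

/-- Complex projective space `ℂℙᴺ`. -/
abbrev CP (N : ℕ) : Type := Projectivization ℂ (Fin (N + 1) → ℂ)

/-- The inclusion of the affine chart `ℂᴺ ⊂ ℂℙᴺ`, `z ↦ [1 : z]`. -/
def affineChart {N : ℕ} (z : Aff N) : CP N :=
  Projectivization.mk ℂ (Fin.cons 1 (fun i => z i) : Fin (N + 1) → ℂ)
    (fun h => one_ne_zero (congrFun h 0))

/-- `g : Ω → ℂᴺ ⊂ ℂℙᴺ` is minimally embedded: its image is contained in no proper projective
subspace of `ℂℙᴺ`. -/
def MinimallyEmbedded {n N : ℕ} (Ω : Set (Aff n)) (g : Aff n → Aff N) : Prop :=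
  ∀ S : Projectivization.Subspace ℂ (Fin (N + 1) → ℂ),
    (∀ z ∈ Ω, affineChart (g z) ∈ S) → S = ⊤

/-- The `1`-modification `ω_{n,f} = ω_n + f^*ω_d` induced by `f`. -/
def oneModification {n d : ℕ} (f : Aff n → Aff d) : TwoForm n := fun z =>
  fubiniStudy n z + pullback f (fubiniStudy d) z

end FubiniStudyGap

end

open scoped Pointwise PowerSeries Nat Matrix ComplexConjugate ComplexOrder

/-! Suppose the two forms agree, and restrict them to a holomorphic curve `γ`. The potentials then
differ by the real part of a holomorphic function, so near the origin `1 + ‖hγ‖² = |G|² (1 + ‖γ‖²)(1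
+ ‖fγ‖²)` with `G` holomorphic (`exists_norm_sq_mul_eq`). Both sides are sums of squared moduli of
holomorphic functions. Such a sum determines the Gram matrix of the Taylor coefficient vectors,
hence the dimension of the span of the germs (`finrank_span_jet_eq`). So the coordinates of `hγ`
span a space of the same dimension as `V * W`, with `V` spanned by the coordinates of `γ` and `W` by
those of `fγ` times `G`.

The curve is chosen (`exists_polyCurve`) to pass near points where the homogeneous coordinates of
`h` are independent, which makes this dimension `m + 1`, and so that `V` contains series of orders
`0, 1, 3, 9, …`, a set of `n + 1` integers with distinct differences. Orders add under
multiplication, so sumset bounds (`mul_card_le_finrank_mul`) give `r (n + 1) - r (r - 1) / 2 ≤ m +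
1` for `r ≤ dim W`, while trivially `m + 1 ≤ (n + 1) dim W`. Taking `r = k + 2` shows that `m`
cannot lie in the gap. -/

namespace FubiniStudyGap

/-! ### Sumsets and orders of power series. -/

/-- A set of naturals with pairwise distinct differences has large sumsets. -/
theorem card_mul_card_le_card_add {E : Finset ℕ}
    (hE : ∀ a ∈ E, ∀ b ∈ E, ∀ c ∈ E, ∀ d ∈ E, a + b = c + d → a = c ∨ a = d) (S : Finset ℕ) :
    S.card * E.card ≤ (S + E).card + S.card.choose 2 := by
  induction S using Finset.induction_on with
  | empty => simp
  | insert s S hs ih =>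
    -- Two distinct translates of `E` share at most one element, so the new translate contributes
    -- all but at most `S.card` of its elements.
    have hinter : ((({s} : Finset ℕ) + E) ∩ (S + E)).card ≤ S.card := by
      have hsub : (({s} : Finset ℕ) + E) ∩ (S + E) ⊆
          S.biUnion fun s' => (({s} : Finset ℕ) + E) ∩ (({s'} : Finset ℕ) + E) := by
        intro x hx
        simp only [Finset.mem_inter, Finset.mem_add, Finset.mem_biUnion,
          Finset.mem_singleton] at hx ⊢
        obtain ⟨h1, s', hs', e, he, rfl⟩ := hx
        exact ⟨s', hs', h1, s', rfl, e, he, rfl⟩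
      refine (Finset.card_le_card hsub).trans ?_
      refine (Finset.card_biUnion_le_card_mul _ _ 1 fun s' hs' => ?_).trans_eq (mul_one _)
      rw [Finset.card_le_one]
      intro x hx y hy
      simp only [Finset.mem_inter, Finset.mem_add, Finset.mem_singleton] at hx hy
      obtain ⟨⟨a, ha, e₁, he₁, h1⟩, b, hb, e₂, he₂, h2⟩ := hx
      obtain ⟨⟨c, hc, e₃, he₃, h3⟩, d, hd, e₄, he₄, h4⟩ := hy
      rcases hE e₁ he₁ e₄ he₄ e₃ he₃ e₂ he₂ (by omega) with h | h
      · omega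
      · have : s' = s := by omega
        exact absurd (this ▸ hs') hs
    have hcard := Finset.card_union_add_card_inter (({s} : Finset ℕ) + E) (S + E)
    have hsE : (({s} : Finset ℕ) + E).card = E.card := by simp
    rw [Finset.insert_eq, Finset.union_add, ← Finset.insert_eq, Finset.card_insert_of_notMem hs,
      Nat.choose_succ_succ' S.card 1, Nat.choose_one_right, add_mul, one_mul]
    have h2 : S.card.choose (1 + 1) = S.card.choose 2 := rfl
    omega

/-- A subspace of dimension at least `r` of power series realises at least `r` orders. -/
theorem exists_finset_order {K : Type*} [Field K] (W : Submodule K K⟦X⟧) [FiniteDimensional K W]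
    (r : ℕ) (hr : r ≤ Module.finrank K W) :
    ∃ S : Finset ℕ, S.card = r ∧ ∀ s ∈ S, ∃ w ∈ W, w.order = s := by
  induction r with
  | zero => exact ⟨∅, by simp⟩
  | succ r ih =>
    obtain ⟨S, hS, hW⟩ := ih (by omega)
    -- A nonzero series in the kernel has zero coefficients at all orders found so far, so its own
    -- order is new.
    let L : W →ₗ[K] (S → K) := LinearMap.pi fun s => (PowerSeries.coeff (s : ℕ)).comp W.subtype
    have hker : LinearMap.ker L ≠ ⊥ := LinearMap.ker_ne_bot_of_finrank_lt (by simp [hS]; omega)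
    obtain ⟨w, hw, hw0⟩ := (Submodule.ne_bot_iff _).1 hker
    have hw0' : (w : K⟦X⟧) ≠ 0 := fun h => hw0 (Subtype.ext h)
    obtain ⟨s, hs⟩ := ENat.ne_top_iff_exists.1
      (fun h => hw0' (PowerSeries.order_eq_top.1 h) : (w : K⟦X⟧).order ≠ ⊤)
    have hsS : s ∉ S := by
      intro h
      have h1 : PowerSeries.coeff s (w : K⟦X⟧) = 0 := congrFun (LinearMap.mem_ker.1 hw) ⟨s, h⟩
      exact (PowerSeries.order_eq_nat.1 hs.symm).1 h1
    refine ⟨insert s S, by rw [Finset.card_insert_of_notMem hsS, hS], ?_⟩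
    intro t ht
    rcases Finset.mem_insert.1 ht with rfl | ht
    · exact ⟨w, w.2, hs.symm⟩
    · exact hW t ht

/-- Power series of distinct orders are linearly independent. -/
theorem card_le_finrank_of_order {K : Type*} [Field K] (W : Submodule K K⟦X⟧)
    [FiniteDimensional K W] (S : Finset ℕ) (hS : ∀ s ∈ S, ∃ w ∈ W, w.order = s) :
    S.card ≤ Module.finrank K W := by
  classical
  choose! w hwW hw using hS
  have hli : LinearIndependent K (fun s : S => (⟨w s, hwW s s.2⟩ : W)) := by
    rw [Fintype.linearIndependent_iff]
    intro g hg
    by_contra! hne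
    have hne' : (Finset.univ.filter fun s : S => g s ≠ 0).Nonempty := by
      obtain ⟨i, hi⟩ := hne
      exact ⟨i, by simpa using hi⟩
    -- At the least order occurring with nonzero coefficient, only one term contributes.
    set s := (Finset.univ.filter fun s : S => g s ≠ 0).min' hne' with hs
    have hgs : g s ≠ 0 := (Finset.mem_filter.1 (Finset.min'_mem _ hne')).2
    have hsum := congrArg (fun x : W => PowerSeries.coeff (s : ℕ) (x : K⟦X⟧)) hg
    simp only [Submodule.coe_sum, Submodule.coe_smul, map_sum, map_smul, ZeroMemClass.coe_zero,
      map_zero, smul_eq_mul] at hsum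
    rw [Finset.sum_eq_single s] at hsum
    · exact (mul_ne_zero hgs (PowerSeries.order_eq_nat.1 (hw s s.2)).1) hsum
    · intro t _ hts
      by_cases hgt : g t = 0
      · simp [hgt]
      · have hle : s ≤ t := Finset.min'_le _ _ (by simpa using hgt)
        have hlt : (s : ℕ) < t := lt_of_le_of_ne hle fun h => hts (Subtype.ext h.symm)
        rw [(PowerSeries.order_eq_nat.1 (hw t t.2)).2 _ hlt, mul_zero]
    · simp
  simpa using hli.fintype_card_le_finrank

/-- Lower bound for the dimension of a product of two subspaces of power series, when the first
realises a set of orders with pairwise distinct differences. -/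
theorem mul_card_le_finrank_mul {K : Type*} [Field K] (V W : Submodule K K⟦X⟧)
    [FiniteDimensional K V] [FiniteDimensional K W] {E : Finset ℕ}
    (hE : ∀ a ∈ E, ∀ b ∈ E, ∀ c ∈ E, ∀ d ∈ E, a + b = c + d → a = c ∨ a = d)
    (hV : ∀ e ∈ E, ∃ v ∈ V, v.order = e) (r : ℕ) (hr : r ≤ Module.finrank K W) :
    r * E.card ≤ Module.finrank K ↥(V * W) + r.choose 2 := by
  obtain ⟨S, rfl, hS⟩ := exists_finset_order W r hr
  have : FiniteDimensional K ↥(V * W) :=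
    Module.Finite.iff_fg.2 ((Module.Finite.iff_fg.1 ‹_›).mul (Module.Finite.iff_fg.1 ‹_›))
  have h := card_le_finrank_of_order (V * W) (S + E) (by
    intro x hx
    obtain ⟨s, hs, e, he, rfl⟩ := Finset.mem_add.1 hx
    obtain ⟨w, hw, hws⟩ := hS s hs
    obtain ⟨v, hv, hve⟩ := hV e he
    refine ⟨v * w, Submodule.mul_mem_mul hv hw, ?_⟩
    rw [PowerSeries.order_mul, hws, hve, add_comm, Nat.cast_add])
  have := card_mul_card_le_card_add hE S
  omega

/-- The product of the span of `N` elements with `W` has dimension at most `N * dim W`. -/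
theorem finrank_span_mul_le {K A ι : Type*} [Field K] [CommRing A] [Algebra K A] [Fintype ι]
    (v : ι → A) (W : Submodule K A) [FiniteDimensional K W] :
    Module.finrank K ↥(Submodule.span K (Set.range v) * W) ≤
      Fintype.card ι * Module.finrank K W := by
  let b := Module.finBasis K W
  have hW : W = Submodule.span K (Set.range fun i => (b i : A)) := by
    have h := congrArg (Submodule.map W.subtype) b.span_eq
    rw [Submodule.map_span, Submodule.map_top, Submodule.range_subtype, ← Set.range_comp] at h
    exact h.symm
  have hmul : Submodule.span K (Set.range v) * W =
      Submodule.span K (Set.range fun p : ι × Fin (Module.finrank K W) => v p.1 * (b p.2 : A)) := by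
    conv_lhs => rw [hW]
    rw [Submodule.span_mul_span]
    congr 1
    ext x
    simp [Set.mem_mul]
  rw [hmul]
  refine (finrank_range_le_card _).trans_eq ?_
  simp

/-- The set `{0, 1, 3, 9, …}` has pairwise distinct differences. -/
theorem zero_or_pow_three_sidon {a b c d : ℕ} (ha : a = 0 ∨ ∃ i : ℕ, a = 3 ^ i)
    (hb : b = 0 ∨ ∃ i : ℕ, b = 3 ^ i) (hc : c = 0 ∨ ∃ i : ℕ, c = 3 ^ i)
    (hd : d = 0 ∨ ∃ i : ℕ, d = 3 ^ i) (h : a + b = c + d) : a = c ∨ a = d := by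
  -- Distinct elements differ by a factor of at least 3, so a largest element on one side exceeds
  -- the sum of two smaller ones on the other; it must occur on both sides.
  have key : ∀ x y : ℕ, (x = 0 ∨ ∃ i : ℕ, x = 3 ^ i) → (y = 0 ∨ ∃ i : ℕ, y = 3 ^ i) →
      x < y → 3 * x ≤ y := by
    rintro x y (rfl | ⟨i, rfl⟩) (rfl | ⟨j, rfl⟩) hxy
    · omega
    · simp
    · omega
    · have hij := (Nat.pow_lt_pow_iff_right (by norm_num : 1 < 3)).1 hxy
      calc 3 * 3 ^ i = 3 ^ (i + 1) := by ring
        _ ≤ 3 ^ j := Nat.pow_le_pow_right (by norm_num) hij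
  have h1 := key a c ha hc
  have h2 := key c a hc ha
  have h3 := key a d ha hd
  have h4 := key d a hd ha
  have h5 := key b c hb hc
  have h6 := key c b hc hb
  have h7 := key b d hb hd
  have h8 := key d b hd hb
  omega

/-! ### Taylor series of holomorphic functions. -/

/-- The Taylor series at `0` of a function of one complex variable. -/
noncomputable def jet (f : ℂ → ℂ) : ℂ⟦X⟧ :=
  PowerSeries.mk fun k => (k ! : ℂ)⁻¹ * iteratedDeriv k f 0

theorem coeff_jet (f : ℂ → ℂ) (k : ℕ) :
    PowerSeries.coeff k (jet f) = (k ! : ℂ)⁻¹ * iteratedDeriv k f 0 :=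
  PowerSeries.coeff_mk _ _

theorem jet_mul {f g : ℂ → ℂ} (hf : AnalyticAt ℂ f 0) (hg : AnalyticAt ℂ g 0) :
    jet (fun t => f t * g t) = jet f * jet g := by
  ext k
  rw [coeff_jet, PowerSeries.coeff_mul, iteratedDeriv_fun_mul hf.contDiffAt hg.contDiffAt,
    Finset.Nat.sum_antidiagonal_eq_sum_range_succ_mk, Finset.mul_sum]
  refine Finset.sum_congr rfl fun i hi => ?_
  have hik : i ≤ k := Nat.lt_succ_iff.1 (Finset.mem_range.1 hi)
  rw [coeff_jet, coeff_jet, Nat.cast_choose ℂ hik]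
  have := Nat.cast_ne_zero (R := ℂ).2 (Nat.factorial_ne_zero k)
  have := Nat.cast_ne_zero (R := ℂ).2 (Nat.factorial_ne_zero i)
  have := Nat.cast_ne_zero (R := ℂ).2 (Nat.factorial_ne_zero (k - i))
  field_simp

theorem jet_sum_mul {ι : Type*} [Fintype ι] (c : ι → ℂ) {f : ι → ℂ → ℂ}
    (hf : ∀ i, AnalyticAt ℂ (f i) 0) :
    jet (fun t => ∑ i, c i * f i t) = ∑ i, c i • jet (f i) := by
  ext k
  have h : iteratedDeriv k (fun t => ∑ i, c i * f i t) 0 = ∑ i, c i * iteratedDeriv k (f i) 0 := by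
    rw [iteratedDeriv_fun_sum (f := fun i t => c i * f i t)
      fun i _ => (analyticAt_const.mul (hf i)).contDiffAt]
    exact Finset.sum_congr rfl fun i _ => iteratedDeriv_const_mul_field _ _
  rw [coeff_jet, h, map_sum, Finset.mul_sum]
  refine Finset.sum_congr rfl fun i _ => ?_
  rw [map_smul, coeff_jet, smul_eq_mul]
  ring

/-- A holomorphic function on a preconnected domain with vanishing Taylor series vanishes. -/
theorem eqOn_zero_of_jet_eq_zero {f : ℂ → ℂ} {D : Set ℂ} (hD : IsOpen D) (hD' : IsPreconnected D)
    (h0 : (0 : ℂ) ∈ D) (hf : DifferentiableOn ℂ f D) (hj : jet f = 0) : Set.EqOn f 0 D := by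
  obtain ⟨r, hr, hrD⟩ := Metric.isOpen_iff.1 hD 0 h0
  refine (hf.analyticOnNhd hD).eqOn_zero_of_preconnected_of_eventuallyEq_zero hD' h0 ?_
  filter_upwards [Metric.ball_mem_nhds _ hr] with z hz
  have hs := Complex.taylorSeries_eq_on_ball (hf.mono hrD) hz
  rw [← hs]
  refine (tsum_congr fun k => ?_).trans tsum_zero
  have hk := congrArg (PowerSeries.coeff k) hj
  rw [coeff_jet, map_zero] at hk
  simp only [smul_eq_mul]
  linear_combination (z - 0) ^ k * hk

/-! ### Gram matrices and sums of squared moduli. -/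

/-- The space spanned by finitely many power series has the same dimension as the space spanned by
the vectors of their coefficients. -/
theorem finrank_span_range_coeff {K ι : Type*} [Field K] [Fintype ι] (p : ι → K⟦X⟧) :
    Module.finrank K (Submodule.span K (Set.range p)) =
      Module.finrank K
        (Submodule.span K (Set.range fun (a : ℕ) (i : ι) => PowerSeries.coeff a (p i))) := by
  classical
  set U := Submodule.span K (Set.range fun (a : ℕ) (i : ι) => PowerSeries.coeff a (p i))
  let e := (Pi.basisFun K ι).toDualEquiv
  have he : ∀ c x : ι → K, e c x = ∑ i, c i * x i := by
    intro c x
    have hc : c = ∑ i, c i • Pi.basisFun K ι i := ((Pi.basisFun K ι).sum_repr c).symm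
    rw [Module.Basis.toDualEquiv_apply]
    conv_lhs => rw [hc]
    rw [map_sum, LinearMap.sum_apply]
    refine Finset.sum_congr rfl fun i _ => ?_
    rw [map_smul, LinearMap.smul_apply, Module.Basis.toDual_apply_right]
    simp
  let Φ := Fintype.linearCombination K p
  -- Row rank equals column rank: `c` is a linear relation among the series exactly when it
  -- annihilates every coefficient vector.
  have hker : LinearMap.ker Φ = U.dualAnnihilator.comap e.toLinearMap := by
    ext c
    rw [LinearMap.mem_ker, Submodule.mem_comap, Submodule.mem_dualAnnihilator]
    constructor
    · intro h x hx
      induction hx using Submodule.span_induction with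
      | mem x hx =>
        obtain ⟨a, rfl⟩ := hx
        have := congrArg (PowerSeries.coeff a) h
        simpa [Φ, Fintype.linearCombination_apply, he] using this
      | zero => simp
      | add x y _ _ hx hy => rw [map_add, hx, hy, add_zero]
      | smul a x _ hx => rw [map_smul, hx, smul_zero]
    · intro h
      ext a
      have := h _ (Submodule.subset_span ⟨a, rfl⟩)
      simpa [Φ, Fintype.linearCombination_apply, he] using this
  have h1 := LinearMap.finrank_range_add_finrank_ker Φ
  have h2 := Subspace.finrank_add_finrank_dualAnnihilator_eq U
  have h3 : Module.finrank K (LinearMap.ker Φ) = Module.finrank K U.dualAnnihilator := by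
    rw [hker]
    exact LinearEquiv.finrank_eq (e.ofSubmodule' U.dualAnnihilator)
  have h4 : LinearMap.range Φ = Submodule.span K (Set.range p) :=
    Fintype.range_linearCombination K p
  rw [h4] at h1
  omega

/-- Families of vectors with the same Gram matrix span spaces of the same dimension. -/
theorem finrank_span_eq_of_gram_eq {α ι κ : Type*} [Fintype ι] [Fintype κ] (u : α → ι → ℂ)
    (v : α → κ → ℂ) (h : ∀ a b, star (u a) ⬝ᵥ u b = star (v a) ⬝ᵥ v b) :
    Module.finrank ℂ (Submodule.span ℂ (Set.range u)) =
      Module.finrank ℂ (Submodule.span ℂ (Set.range v)) := by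
  have hgram : ∀ c : α →₀ ℂ,
      star (Finsupp.linearCombination ℂ u c) ⬝ᵥ Finsupp.linearCombination ℂ u c =
        star (Finsupp.linearCombination ℂ v c) ⬝ᵥ Finsupp.linearCombination ℂ v c := by
    intro c
    simp only [Finsupp.linearCombination_apply, Finsupp.sum, star_sum, star_smul, sum_dotProduct,
      dotProduct_sum, smul_dotProduct, dotProduct_smul, h]
  -- The Gram matrix gives the norm of every combination, hence tells which ones vanish.
  have hker : LinearMap.ker (Finsupp.linearCombination ℂ u) =
      LinearMap.ker (Finsupp.linearCombination ℂ v) := by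
    ext c
    rw [LinearMap.mem_ker, LinearMap.mem_ker, ← dotProduct_star_self_eq_zero, hgram,
      dotProduct_star_self_eq_zero]
  rw [← Finsupp.range_linearCombination, ← Finsupp.range_linearCombination]
  exact LinearEquiv.finrank_eq ((LinearMap.quotKerEquivRange _).symm.trans
    ((Submodule.quotEquivOfEq _ _ hker).trans (LinearMap.quotKerEquivRange _)))

/-- Applying `∂` and `∂̄` to a vanishing sesquilinear expression in holomorphic functions. -/
theorem sum_conj_mul_deriv_eq_zero {ι : Type*} [Fintype ι] {U : Set ℂ} (hU : IsOpen U) (ε : ι → ℂ)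
    {F G : ι → ℂ → ℂ} (hF : ∀ i, DifferentiableOn ℂ (F i) U)
    (hG : ∀ i, DifferentiableOn ℂ (G i) U)
    (h : ∀ t ∈ U, ∑ i, ε i * (conj (F i t) * G i t) = 0) {t : ℂ} (ht : t ∈ U) :
    ∑ i, ε i * (conj (deriv (F i) t) * G i t) = 0 ∧
      ∑ i, ε i * (conj (F i t) * deriv (G i) t) = 0 := by
  have hd : HasFDerivAt (𝕜 := ℝ) (fun s => ∑ i, ε i * (conj (F i s) * G i s))
      (∑ i, ε i • (conj (F i t) • (deriv (G i) t • (1 : ℂ →L[ℝ] ℂ)) +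
        G i t • ((Complex.conjCLE : ℂ →L[ℝ] ℂ).comp (deriv (F i) t • (1 : ℂ →L[ℝ] ℂ))))) t := by
    refine HasFDerivAt.fun_sum fun i _ => HasFDerivAt.const_mul ?_ _
    have h1 := ((hF i).differentiableAt (hU.mem_nhds ht)).hasDerivAt.complexToReal_fderiv
    have h2 := ((hG i).differentiableAt (hU.mem_nhds ht)).hasDerivAt.complexToReal_fderiv
    have h3 := (Complex.conjCLE : ℂ →L[ℝ] ℂ).hasFDerivAt.comp t h1
    exact h3.mul h2
  have h0 := hd.unique ((hasFDerivAt_const (0 : ℂ) t).congr_of_eventuallyEq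
    (Filter.eventually_of_mem (hU.mem_nhds ht) h))
  -- The differential is `s ↦ s * Y + conj s * X`; the directions `1` and `I` separate the two
  -- parts.
  have e1 := congrArg (fun L : ℂ →L[ℝ] ℂ => L 1) h0
  have e2 := congrArg (fun L : ℂ →L[ℝ] ℂ => L Complex.I) h0
  simp only [sum_apply, smul_apply,
    add_apply, ContinuousLinearMap.comp_apply, one_apply_eq_self,
    ContinuousLinearEquiv.coe_coe, Complex.conjCLE_apply, smul_eq_mul, map_mul, Complex.conj_I,
    mul_one, zero_apply] at e1 e2
  set X := ∑ i, ε i * (conj (deriv (F i) t) * G i t) with hX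
  set Y := ∑ i, ε i * (conj (F i t) * deriv (G i) t) with hY
  have e1' : X + Y = 0 := by
    rw [← e1, hX, hY, ← Finset.sum_add_distrib]
    exact Finset.sum_congr rfl fun i _ => by ring
  have e2' : Complex.I * (Y - X) = 0 := by
    rw [← e2, hX, hY, ← Finset.sum_sub_distrib, Finset.mul_sum]
    exact Finset.sum_congr rfl fun i _ => by ring
  have e3 : Y - X = 0 := (mul_eq_zero.1 e2').resolve_left Complex.I_ne_zero
  constructor
  · linear_combination e1' / 2 - e3 / 2
  · linear_combination e1' / 2 + e3 / 2

/-- `∂` acts only on the holomorphic factor and `∂̄` only on the conjugate one, so the shape of the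
identity survives differentiation. At one point these are the Gram relations between Taylor
coefficients. -/
theorem sum_conj_mul_iteratedDeriv_eq_zero {ι : Type*} [Fintype ι] {U : Set ℂ} (hU : IsOpen U)
    (ε : ι → ℂ) {F : ι → ℂ → ℂ} (hF : ∀ i, DifferentiableOn ℂ (F i) U)
    (h : ∀ t ∈ U, ∑ i, ε i * (conj (F i t) * F i t) = 0) (a b : ℕ) {t : ℂ} (ht : t ∈ U) :
    ∑ i, ε i * (conj (iteratedDeriv a (F i) t) * iteratedDeriv b (F i) t) = 0 := by
  have hdiff : ∀ (k : ℕ) (i : ι), DifferentiableOn ℂ (iteratedDeriv k (F i)) U := by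
    intro k i
    induction k with
    | zero => simpa using hF i
    | succ k ih => rw [iteratedDeriv_succ]; exact ih.deriv hU
  induction a generalizing t with
  | zero =>
    induction b generalizing t with
    | zero => simpa using h t ht
    | succ b ih =>
      simp only [iteratedDeriv_succ (n := b)]
      exact (sum_conj_mul_deriv_eq_zero hU ε (hdiff 0) (hdiff b) (fun t ht => ih ht) ht).2
  | succ a ih =>
    simp only [iteratedDeriv_succ (n := a)]
    exact (sum_conj_mul_deriv_eq_zero hU ε (hdiff a) (hdiff b) (fun t ht => ih ht) ht).1

/-- Two holomorphic families with the same sum of squared moduli span spaces of germs of the same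
dimension. -/
theorem finrank_span_jet_eq {ι κ : Type*} [Fintype ι] [Fintype κ] {U : Set ℂ} (hU : IsOpen U)
    (h0 : (0 : ℂ) ∈ U) {A : ι → ℂ → ℂ} {B : κ → ℂ → ℂ} (hA : ∀ i, DifferentiableOn ℂ (A i) U)
    (hB : ∀ j, DifferentiableOn ℂ (B j) U)
    (h : ∀ t ∈ U, ∑ i, ‖A i t‖ ^ 2 = ∑ j, ‖B j t‖ ^ 2) :
    Module.finrank ℂ (Submodule.span ℂ (Set.range fun i => jet (A i))) =
      Module.finrank ℂ (Submodule.span ℂ (Set.range fun j => jet (B j))) := by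
  rw [finrank_span_range_coeff, finrank_span_range_coeff]
  refine finrank_span_eq_of_gram_eq _ _ fun a b => ?_
  -- Signs `1` and `-1` turn the equality of two sums into one vanishing sum.
  have key := sum_conj_mul_iteratedDeriv_eq_zero hU (Sum.elim (fun _ : ι => 1) (fun _ : κ => -1))
    (F := Sum.elim A B) (by rintro (i | j); exacts [hA i, hB j]) (by
      intro t ht
      have := congrArg (fun x : ℝ => (x : ℂ)) (h t ht)
      push_cast at this
      simp only [Fintype.sum_sum_type, Sum.elim_inl, Sum.elim_inr, Complex.conj_mul', one_mul,
        neg_mul, Finset.sum_neg_distrib]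
      rw [this, add_neg_cancel]) a b h0
  simp only [Fintype.sum_sum_type, Sum.elim_inl, Sum.elim_inr, one_mul, neg_mul,
    Finset.sum_neg_distrib, ← sub_eq_add_neg, sub_eq_zero] at key
  simp only [dotProduct, Pi.star_apply, coeff_jet, star_mul', RCLike.star_def, map_inv₀,
    map_natCast]
  have hfac : ∀ x y : ℂ, (a ! : ℂ)⁻¹ * x * ((b ! : ℂ)⁻¹ * y) =
      (a ! : ℂ)⁻¹ * (b ! : ℂ)⁻¹ * (x * y) := fun x y => by ring
  simp only [hfac, ← Finset.mul_sum, key]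

/-! ### Potentials along holomorphic curves. -/

section Potential

variable {E E₁ E₂ : Type*} [NormedAddCommGroup E] [InnerProductSpace ℂ E]
  [NormedAddCommGroup E₁] [InnerProductSpace ℂ E₁] [NormedAddCommGroup E₂]
  [InnerProductSpace ℂ E₂]

/-- The Hermitian form `∂∂̄ log (1 + ‖w‖²)` at `w`, evaluated on the vector `v`. -/
noncomputable def leviForm (w v : E) : ℂ :=
  inner ℂ v v / (1 + inner ℂ w w) - inner ℂ w v * inner ℂ v w / (1 + inner ℂ w w) ^ 2

/-- The derivative `∂ log (1 + ‖g‖²)` along a holomorphic curve `g`. -/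
noncomputable def logDerivative (g : ℂ → E) (t : ℂ) : ℂ :=
  inner ℂ (g t) (deriv g t) / (1 + inner ℂ (g t) (g t))

theorem one_add_inner_self (w : E) : (1 + inner ℂ w w : ℂ) = ((1 + ‖w‖ ^ 2 : ℝ) : ℂ) := by
  rw [inner_self_eq_norm_sq_to_K]
  push_cast
  rfl

theorem one_add_inner_self_ne_zero (w : E) : (1 + inner ℂ w w : ℂ) ≠ 0 := by
  rw [one_add_inner_self]
  exact_mod_cast (show (0 : ℝ) < 1 + ‖w‖ ^ 2 by positivity).ne'

theorem hasFDerivAt_one_add_inner_self {g : ℂ → E} {g' : E} {t : ℂ} (hg : HasDerivAt g g' t) :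
    ∃ L : ℂ →L[ℝ] ℂ, HasFDerivAt (𝕜 := ℝ) (fun s => (1 + inner ℂ (g s) (g s) : ℂ)) L t ∧
      ∀ s, L s = s * inner ℂ (g t) g' + conj s * inner ℂ g' (g t) := by
  have h1 := hg.hasFDerivAt.restrictScalars ℝ
  refine ⟨_, (h1.inner ℂ h1).const_add 1, fun s => ?_⟩
  simp [fderivInnerCLM_apply, inner_smul_left, inner_smul_right]

/-- The conjugate-linear part, `∂̄∂` of the potential, is what matters; `P` only records the
complex-linear part. -/
theorem hasFDerivAt_logDerivative [CompleteSpace E] {g : ℂ → E} {U : Set ℂ} (hU : IsOpen U)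
    (hg : DifferentiableOn ℂ g U) {t : ℂ} (ht : t ∈ U) :
    ∃ (L : ℂ →L[ℝ] ℂ) (P : ℂ), HasFDerivAt (𝕜 := ℝ) (logDerivative g) L t ∧
      ∀ s, L s = s * P + conj s * leviForm (g t) (deriv g t) := by
  have hg1 := (hg.differentiableAt (hU.mem_nhds ht)).hasDerivAt
  have hg2 := ((hg.deriv hU).differentiableAt (hU.mem_nhds ht)).hasDerivAt
  have h1 := hg1.hasFDerivAt.restrictScalars ℝ
  have h2 := hg2.hasFDerivAt.restrictScalars ℝ
  obtain ⟨L, hL, hLs⟩ := hasFDerivAt_one_add_inner_self hg1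
  have hS := one_add_inner_self_ne_zero (g t)
  have h3 := (h1.inner ℂ h2).mul (((hasDerivAt_inv hS).hasFDerivAt.restrictScalars ℝ).comp t hL)
  refine ⟨_, inner ℂ (g t) (deriv (deriv g) t) / (1 + inner ℂ (g t) (g t)) -
    inner ℂ (g t) (deriv g t) * inner ℂ (g t) (deriv g t) / (1 + inner ℂ (g t) (g t)) ^ 2,
    h3.congr_of_eventuallyEq (Filter.Eventually.of_forall fun s => ?_), fun s => ?_⟩
  · simp [logDerivative, div_eq_mul_inv]
  · simp only [leviForm, Function.comp_apply, add_apply, smul_apply,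
      ContinuousLinearMap.comp_apply, ContinuousLinearMap.coe_restrictScalars',
      ContinuousLinearMap.toSpanSingleton_apply, hLs, fderivInnerCLM_apply,
      ContinuousLinearMap.prod_apply, inner_smul_left, inner_smul_right, smul_eq_mul]
    field_simp
    ring

theorem hasFDerivAt_log_one_add_norm_sq {g : ℂ → E} {t : ℂ} (hg : DifferentiableAt ℂ g t) :
    ∃ L : ℂ →L[ℝ] ℝ, HasFDerivAt (fun s => Real.log (1 + ‖g s‖ ^ 2)) L t ∧
      ∀ s, L s = 2 * (s * logDerivative g t).re := by
  obtain ⟨L, hL, hLs⟩ := hasFDerivAt_one_add_inner_self hg.hasDerivAt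
  have h1 := (Complex.reCLM.hasFDerivAt.comp t hL).log (by
    simp only [Function.comp_apply, one_add_inner_self, Complex.reCLM_apply, Complex.ofReal_re]
    positivity)
  refine ⟨_, h1.congr_of_eventuallyEq (Filter.Eventually.of_forall fun s => ?_), fun s => ?_⟩
  · simp only [Function.comp_apply, one_add_inner_self, Complex.reCLM_apply, Complex.ofReal_re]
  · have hconj : conj s * inner ℂ (deriv g t) (g t) = conj (s * inner ℂ (g t) (deriv g t)) := by
      rw [map_mul, inner_conj_symm]
    simp only [logDerivative, smul_apply, ContinuousLinearMap.comp_apply, hLs, hconj,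
      Function.comp_apply, one_add_inner_self, Complex.reCLM_apply, Complex.ofReal_re,
      ← mul_div_assoc, Complex.div_ofReal_re, Complex.add_re, Complex.conj_re, smul_eq_mul]
    ring

/-- If the Levi forms of the potentials `log (1 + ‖·‖²)` along three holomorphic curves satisfy
`a = b + c`, the potentials differ by the real part of a holomorphic function. -/
theorem exists_norm_sq_mul_eq [CompleteSpace E] [CompleteSpace E₁] [CompleteSpace E₂]
    {r : ℝ} {a : ℂ → E} {b : ℂ → E₁} {c : ℂ → E₂}
    (ha : DifferentiableOn ℂ a (Metric.ball 0 r)) (hb : DifferentiableOn ℂ b (Metric.ball 0 r))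
    (hc : DifferentiableOn ℂ c (Metric.ball 0 r))
    (h : ∀ t ∈ Metric.ball (0 : ℂ) r, leviForm (a t) (deriv a t) =
      leviForm (b t) (deriv b t) + leviForm (c t) (deriv c t)) :
    ∃ G : ℂ → ℂ, DifferentiableOn ℂ G (Metric.ball 0 r) ∧ ∀ t ∈ Metric.ball (0 : ℂ) r,
      1 + ‖a t‖ ^ 2 = ‖G t‖ ^ 2 * ((1 + ‖b t‖ ^ 2) * (1 + ‖c t‖ ^ 2)) := by
  have hU : IsOpen (Metric.ball (0 : ℂ) r) := Metric.isOpen_ball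
  -- `θ` is `∂` of the difference of potentials. By `h` its `∂̄`-derivative vanishes, so it is
  -- holomorphic and has a primitive `g` on the disc.
  let θ : ℂ → ℂ := fun t => logDerivative a t - logDerivative b t - logDerivative c t
  have hθ : DifferentiableOn ℂ θ (Metric.ball 0 r) := by
    intro t ht
    obtain ⟨La, Pa, hLa, ea⟩ := hasFDerivAt_logDerivative hU ha ht
    obtain ⟨Lb, Pb, hLb, eb⟩ := hasFDerivAt_logDerivative hU hb ht
    obtain ⟨Lc, Pc, hLc, ec⟩ := hasFDerivAt_logDerivative hU hc ht
    have hd := (hLa.sub hLb).sub hLc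
    refine DifferentiableAt.differentiableWithinAt ?_
    refine (differentiableAt_iff_restrictScalars ℝ hd.differentiableAt).2
      ⟨ContinuousLinearMap.toSpanSingleton ℂ (Pa - Pb - Pc), ?_⟩
    rw [hd.fderiv]
    ext s
    simp only [ContinuousLinearMap.coe_restrictScalars',
      ContinuousLinearMap.toSpanSingleton_apply, sub_apply, ea, eb, ec, smul_eq_mul]
    linear_combination - conj s * h t ht
  obtain ⟨g, hg⟩ := hθ.isExactOn_ball
  let u : ℂ → ℝ := fun t => Real.log (1 + ‖a t‖ ^ 2) - Real.log (1 + ‖b t‖ ^ 2) -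
    Real.log (1 + ‖c t‖ ^ 2) - 2 * (g t).re
  have hder : ∀ t ∈ Metric.ball (0 : ℂ) r, ∃ L : ℂ →L[ℝ] ℝ, HasFDerivAt u L t ∧ L = 0 := by
    intro t ht
    obtain ⟨La, hLa, ea⟩ := hasFDerivAt_log_one_add_norm_sq (ha.differentiableAt (hU.mem_nhds ht))
    obtain ⟨Lb, hLb, eb⟩ := hasFDerivAt_log_one_add_norm_sq (hb.differentiableAt (hU.mem_nhds ht))
    obtain ⟨Lc, hLc, ec⟩ := hasFDerivAt_log_one_add_norm_sq (hc.differentiableAt (hU.mem_nhds ht))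
    have hre := (Complex.reCLM.hasFDerivAt.comp t
      ((hg t ht).hasFDerivAt.restrictScalars ℝ)).const_mul 2
    refine ⟨_, ((hLa.sub hLb).sub hLc).sub hre, ?_⟩
    ext1 s
    simp only [sub_apply, smul_apply, ea, eb, ec, ContinuousLinearMap.comp_apply, zero_apply,
      ContinuousLinearMap.coe_restrictScalars', ContinuousLinearMap.toSpanSingleton_apply,
      smul_eq_mul, Complex.reCLM_apply, θ, mul_sub, Complex.sub_re]
    ring
  have hu : ∃ C, ∀ t ∈ Metric.ball (0 : ℂ) r, u t = C := by
    refine hU.exists_is_const_of_fderiv_eq_zero (𝕜 := ℝ) (convex_ball _ _).isPreconnected ?_ ?_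
    · intro t ht
      obtain ⟨L, hL, -⟩ := hder t ht
      exact hL.differentiableAt.differentiableWithinAt
    · intro t ht
      obtain ⟨L, hL, hL0⟩ := hder t ht
      rw [hL.fderiv, hL0]
      rfl
  obtain ⟨C, hC⟩ := hu
  -- Chosen so that `‖G‖² = exp (2 Re g + C)`.
  refine ⟨fun t => Complex.exp (g t + (C / 2 : ℝ)), fun t ht =>
    ((hg t ht).differentiableAt.add_const _).cexp.differentiableWithinAt, fun t ht => ?_⟩
  have hCt : Real.log (1 + ‖a t‖ ^ 2) =
      Real.log (1 + ‖b t‖ ^ 2) + Real.log (1 + ‖c t‖ ^ 2) + 2 * ((g t).re + C / 2) := by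
    have := hC t ht
    simp only [u] at this
    linarith
  have pos : ∀ x : ℝ, 0 < 1 + x ^ 2 := fun x => by positivity
  rw [← Real.exp_log (pos ‖a t‖), hCt, Real.exp_add, Real.exp_add, Real.exp_log (pos _),
    Real.exp_log (pos _), Complex.norm_exp, Complex.add_re, Complex.ofReal_re, ← Real.exp_nat_mul]
  push_cast
  ring

end Potential

/-! ### The Fubini–Study form in coordinates. -/

theorem dz_apply {N : ℕ} (j : Fin N) (v : Aff N) : dz j v = v j := rfl

theorem dzBar_apply {N : ℕ} (j : Fin N) (v : Aff N) : dzBar j v = conj (v j) := rfl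

theorem wirtingerBar_log {N : ℕ} (k : Fin N) (w : Aff N) :
    wirtingerBar k (fun w : Aff N => ((Real.log (1 + ‖w‖ ^ 2) : ℝ) : ℂ)) w =
      w k / (1 + inner ℂ w w) := by
  have h1 : HasFDerivAt (fun w : Aff N => 1 + ‖w‖ ^ 2) _ w :=
    ((hasFDerivAt_id (𝕜 := ℝ) w).norm_sq).const_add 1
  have h2 := Complex.ofRealCLM.hasFDerivAt.comp w
    (h1.log (show (0 : ℝ) < 1 + ‖w‖ ^ 2 by positivity).ne')
  have hS := one_add_inner_self_ne_zero w
  rw [one_add_inner_self] at hS ⊢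
  have hre : ∀ s : Aff N, inner ℝ w s = (inner ℂ w s).re := fun s => by
    simp [PiLp.inner_apply, Complex.inner, Complex.re_sum, mul_comm]
  have h3 : fderiv ℝ (fun w : Aff N => ((Real.log (1 + ‖w‖ ^ 2) : ℝ) : ℂ)) w = _ := h2.fderiv
  rw [wirtingerBar, h3]
  simp only [ContinuousLinearMap.comp_apply, smul_apply, Complex.ofRealCLM_apply, smul_eq_mul,
    innerSL_apply_apply, hre, EuclideanSpace.inner_single_right, id, ContinuousLinearMap.id_apply]
  have hw : w k = (w k).re + (w k).im * Complex.I := (Complex.re_add_im _).symm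
  simp
  field_simp
  linear_combination -hw

theorem wirtinger_wirtingerBar_log {N : ℕ} (j k : Fin N) (w : Aff N) :
    wirtinger j (wirtingerBar k (fun w : Aff N => ((Real.log (1 + ‖w‖ ^ 2) : ℝ) : ℂ))) w =
      (if j = k then 1 else 0) / (1 + inner ℂ w w) -
        w k * conj (w j) / (1 + inner ℂ w w) ^ 2 := by
  rw [funext (wirtingerBar_log k)]
  have hS := one_add_inner_self_ne_zero w
  have h1 : HasFDerivAt (𝕜 := ℝ) (fun w : Aff N => w k) (dz k) w := (dz k).hasFDerivAt
  have h2 : HasFDerivAt (𝕜 := ℝ) (fun w : Aff N => (1 + inner ℂ w w : ℂ)) _ w :=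
    ((hasFDerivAt_id (𝕜 := ℝ) w).inner ℂ (hasFDerivAt_id (𝕜 := ℝ) w)).const_add 1
  have h3 := h1.mul (((hasDerivAt_inv hS).hasFDerivAt.restrictScalars ℝ).comp w h2)
  have h4 : fderiv ℝ (fun w : Aff N => w k / (1 + inner ℂ w w)) w = _ :=
    (h3.congr_of_eventuallyEq (Filter.Eventually.of_forall fun s => by
      simp [div_eq_mul_inv])).fderiv
  rw [wirtinger, h4]
  simp only [Function.comp_apply, add_apply, smul_apply,
      ContinuousLinearMap.comp_apply, ContinuousLinearMap.coe_restrictScalars',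
      ContinuousLinearMap.toSpanSingleton_apply, fderivInnerCLM_apply, dz_apply,
      ContinuousLinearMap.prod_apply, smul_eq_mul, id, ContinuousLinearMap.id_apply,
      EuclideanSpace.inner_single_right, EuclideanSpace.inner_single_left,
      PiLp.single_apply, Complex.conj_I, map_one, eq_comm (a := k)]
  split_ifs <;> field_simp <;> ring_nf <;> simp only [Complex.I_sq] <;> ring

/-- Evaluation on `(v, I • v)` recovers the Hermitian form of a `(1,1)`-form: `dz_j ∧ dz̄_k` takes
the value `-2i v_j v̄_k`, and `(i / 2π)(-2i) = 1 / π`. -/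
theorem fubiniStudy_apply_I_smul {N : ℕ} (w v : Aff N) :
    fubiniStudy N w ![v, Complex.I • v] = (Real.pi : ℂ)⁻¹ * leviForm w v := by
  have hinner : ∀ x y : Aff N, (inner ℂ x y : ℂ) = ∑ i, conj (x i) * y i := fun x y => by
    simp [PiLp.inner_apply, mul_comm]
  have hsum : ddbar (fun w : Aff N => ((Real.log (1 + ‖w‖ ^ 2) : ℝ) : ℂ)) w ![v, Complex.I • v] =
      -2 * Complex.I * leviForm w v := by
    simp only [ddbar, ContinuousAlternatingMap.sum_apply, ContinuousAlternatingMap.smul_apply,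
      wedge_apply, wirtinger_wirtingerBar_log, leviForm]
    generalize (1 + inner ℂ w w : ℂ) = S
    have e : ∀ j k : Fin N, ((if j = k then 1 else 0) / S - w k * conj (w j) / S ^ 2) •
        (dz j v * dzBar k (Complex.I • v) - dz j (Complex.I • v) * dzBar k v) =
        -2 * Complex.I * ((if j = k then conj (v k) * v j else 0) / S -
          (conj (w j) * v j) * (conj (v k) * w k) / S ^ 2) := by
      intro j k
      simp only [dz_apply, dzBar_apply, PiLp.smul_apply, smul_eq_mul, map_mul, Complex.conj_I]
      split_ifs <;> ring
    simp only [e, ← Finset.mul_sum, Finset.sum_sub_distrib, ← Finset.sum_div,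
      Finset.sum_ite_eq, Finset.mem_univ, if_true, hinner, ← Finset.sum_mul]
  rw [fubiniStudy, ContinuousAlternatingMap.smul_apply, hsum, smul_eq_mul]
  have := Complex.ofReal_ne_zero.2 Real.pi_ne_zero
  field_simp
  linear_combination (-leviForm w v) * Complex.I_sq

theorem pullback_fubiniStudy_apply {n N : ℕ} {g : Aff n → Aff N} {z : Aff n}
    (hg : DifferentiableAt ℂ g z) (v : Aff n) :
    pullback g (fubiniStudy N) z ![v, Complex.I • v] =
      (Real.pi : ℂ)⁻¹ * leviForm (g z) (fderiv ℂ g z v) := by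
  have hf : fderiv ℝ g z = (fderiv ℂ g z).restrictScalars ℝ :=
    (hg.hasFDerivAt.restrictScalars ℝ).fderiv
  rw [← fubiniStudy_apply_I_smul, pullback, ContinuousAlternatingMap.compContinuousLinearMap_apply,
    hf]
  congr 1
  ext i
  fin_cases i <;> simp

/-- Equality of `h^*ω_m` and `ω_{n,f}` read along a holomorphic curve. -/
theorem leviForm_comp_eq {n m d : ℕ} {Ω : Set (Aff n)} (hΩ : IsOpen Ω) {h : Aff n → Aff m}
    {f : Aff n → Aff d} (hh : DifferentiableOn ℂ h Ω) (hf : DifferentiableOn ℂ f Ω)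
    (heq : Set.EqOn (pullback h (fubiniStudy m)) (oneModification f) Ω) {γ : ℂ → Aff n} {t : ℂ}
    (hγ : DifferentiableAt ℂ γ t) (ht : γ t ∈ Ω) :
    leviForm ((h ∘ γ) t) (deriv (h ∘ γ) t) =
      leviForm (γ t) (deriv γ t) + leviForm ((f ∘ γ) t) (deriv (f ∘ γ) t) := by
  have hh' := hh.differentiableAt (hΩ.mem_nhds ht)
  have hf' := hf.differentiableAt (hΩ.mem_nhds ht)
  have e := congrArg (fun η : (Aff n) [⋀^Fin 2]→L[ℝ] ℂ => η ![deriv γ t, Complex.I • deriv γ t])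
    (heq ht)
  simp only [oneModification, ContinuousAlternatingMap.add_apply, pullback_fubiniStudy_apply hh',
    pullback_fubiniStudy_apply hf', fubiniStudy_apply_I_smul, ← mul_add] at e
  rw [(hh'.hasFDerivAt.comp_hasDerivAt t hγ.hasDerivAt).deriv,
    (hf'.hasFDerivAt.comp_hasDerivAt t hγ.hasDerivAt).deriv]
  exact mul_left_cancel₀ (inv_ne_zero (Complex.ofReal_ne_zero.2 Real.pi_ne_zero)) e

/-! ### Minimality and the choice of the curve. -/

/-- Homogeneous coordinates of a point of the affine chart. -/
def homogeneous {N : ℕ} (z : Aff N) : Fin (N + 1) → ℂ := Fin.cons 1 (fun i => z i)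

/-- Minimality says that the homogeneous coordinate vectors of the image span the whole space, so a
basis can be extracted from them. Finitely many points are then enough for a curve to detect
minimality. -/
theorem MinimallyEmbedded.exists_linearIndependent {n m : ℕ} {Ω : Set (Aff n)}
    {h : Aff n → Aff m} (hmin : MinimallyEmbedded Ω h) :
    ∃ q : Fin (m + 1) → Aff n, (∀ i, q i ∈ Ω) ∧
      LinearIndependent ℂ fun i => homogeneous (h (q i)) := by
  set s : Set (Fin (m + 1) → ℂ) := (fun z => homogeneous (h z)) '' Ω
  have htop : Submodule.span ℂ s = ⊤ := by
    have h1 := hmin (Submodule.span ℂ s).projectivization fun z hz =>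
      (Submodule.mk_mem_projectivization_iff _ _).2 (Submodule.subset_span ⟨z, hz, rfl⟩)
    exact (map_eq_top_iff Submodule.projectivization).1 h1
  obtain ⟨v, hv, -, hli⟩ := Submodule.exists_fun_fin_finrank_span_eq ℂ s
  have hr : Module.finrank ℂ (Submodule.span ℂ s) = m + 1 := by
    rw [htop, finrank_top, Module.finrank_fin_fun]
  choose q hq hqv using hv
  refine ⟨fun i => q (finCongr hr.symm i), fun i => hq _, ?_⟩
  simp only [hqv]
  exact hli.comp _ (finCongr hr.symm).injective

/-- Linear independence of the vectors of homogeneous coordinates is an open condition. -/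
theorem exists_forall_dist_lt_linearIndependent {n m : ℕ} {Ω : Set (Aff n)} (hΩ : IsOpen Ω)
    {h : Aff n → Aff m} (hh : ContinuousOn h Ω) {q : Fin (m + 1) → Aff n} (hq : ∀ i, q i ∈ Ω)
    (hli : LinearIndependent ℂ fun i => homogeneous (h (q i))) :
    ∃ δ > 0, ∀ x : Fin (m + 1) → Aff n, (∀ i, dist (x i) (q i) < δ) →
      LinearIndependent ℂ fun i => homogeneous (h (x i)) := by
  have hc : ContinuousAt (fun (x : Fin (m + 1) → Aff n) i => homogeneous (h (x i))) q := by
    refine continuousAt_pi.2 fun i => ?_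
    have hi : ContinuousAt (fun x : Fin (m + 1) → Aff n => h (x i)) q :=
      ContinuousAt.comp (f := fun x : Fin (m + 1) → Aff n => x i) (g := h)
        (hh.continuousAt (hΩ.mem_nhds (hq i))) (continuous_apply i).continuousAt
    refine continuousAt_pi.2 fun j => ?_
    refine Fin.cases ?_ (fun j => ?_) j
    · exact continuousAt_const
    · exact (EuclideanSpace.proj (𝕜 := ℂ) j).continuous.continuousAt.comp hi
  have hev := hc.eventually (isOpen_setOfPred_linearIndependent.mem_nhds hli)
  obtain ⟨δ, hδ, H⟩ := Metric.eventually_nhds_iff.1 hev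
  exact ⟨δ, hδ, fun x hx => H ((dist_pi_lt_iff hδ).2 hx)⟩

/-- Complex polynomial approximation on `[0, 1]`, with nonzero constant term. -/
theorem exists_polynomial_near_eval_zero_ne_zero {f : ℝ → ℂ} (hf : Continuous f) {ε : ℝ}
    (hε : 0 < ε) : ∃ Q : Polynomial ℂ, Q.eval 0 ≠ 0 ∧
      ∀ x ∈ Set.Icc (0 : ℝ) 1, ‖Q.eval (x : ℂ) - f x‖ < ε := by
  obtain ⟨p, hp⟩ := exists_polynomial_near_of_continuousOn 0 1 (fun x => (f x).re)
    (Complex.continuous_re.comp hf).continuousOn (ε / 4) (by positivity)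
  obtain ⟨q, hq⟩ := exists_polynomial_near_of_continuousOn 0 1 (fun x => (f x).im)
    (Complex.continuous_im.comp hf).continuousOn (ε / 4) (by positivity)
  let P : Polynomial ℂ := p.map Complex.ofRealHom + Polynomial.C Complex.I * q.map Complex.ofRealHom
  have hP : ∀ x ∈ Set.Icc (0 : ℝ) 1, ‖P.eval (x : ℂ) - f x‖ < ε / 2 := by
    intro x hx
    have hev : ∀ s : Polynomial ℝ, (s.map Complex.ofRealHom).eval (x : ℂ) = (s.eval x : ℝ) := by
      intro s
      exact Polynomial.eval_map_apply Complex.ofRealHom x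
    have hPx : P.eval (x : ℂ) - f x =
        ((p.eval x - (f x).re : ℝ) : ℂ) + Complex.I * ((q.eval x - (f x).im : ℝ) : ℂ) := by
      simp only [P, Polynomial.eval_add, Polynomial.eval_mul, Polynomial.eval_C, hev]
      push_cast
      linear_combination Complex.re_add_im (f x)
    rw [hPx]
    refine (norm_add_le _ _).trans_lt ?_
    rw [norm_mul, Complex.norm_I, one_mul, Complex.norm_real, Complex.norm_real]
    have := hp x hx
    have := hq x hx
    simp only [Real.norm_eq_abs]
    linarith
  by_cases h0 : P.eval 0 = 0
  · refine ⟨P + Polynomial.C ((ε / 2 : ℝ) : ℂ), ?_, fun x hx => ?_⟩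
    · rw [Polynomial.eval_add, h0, Polynomial.eval_C, zero_add]
      exact Complex.ofReal_ne_zero.2 (by positivity)
    · rw [Polynomial.eval_add, Polynomial.eval_C, add_sub_right_comm]
      refine (norm_add_le _ _).trans_lt ?_
      rw [Complex.norm_real, Real.norm_of_nonneg (by positivity)]
      linarith [hP x hx]
  · exact ⟨P, h0, fun x hx => (hP x hx).trans (by linarith)⟩

/-- The polynomial curve with components `c i + t ^ a i * Q i (t)`. -/
def polyCurve {n : ℕ} (c : Fin n → ℂ) (a : Fin n → ℕ) (Q : Fin n → Polynomial ℂ) (t : ℂ) : Aff n :=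
  WithLp.toLp 2 fun i => c i + t ^ a i * (Q i).eval t

theorem polyCurve_apply {n : ℕ} (c : Fin n → ℂ) (a : Fin n → ℕ) (Q : Fin n → Polynomial ℂ) (t : ℂ)
    (i : Fin n) : polyCurve c a Q t i = c i + t ^ a i * (Q i).eval t := rfl

theorem differentiable_polyCurve {n : ℕ} (c : Fin n → ℂ) (a : Fin n → ℕ)
    (Q : Fin n → Polynomial ℂ) : Differentiable ℂ (polyCurve c a Q) := by
  rw [differentiable_euclidean]
  intro i
  simp only [polyCurve_apply]
  exact ((differentiable_id.pow _).mul (Q i).differentiable).const_add _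

theorem dist_lt_of_forall_norm_lt {n : ℕ} {x y : Aff n} {η : ℝ} (hη : 0 < η)
    (h : ∀ i, ‖x i - y i‖ < η / (n + 1)) : dist x y < η := by
  rw [EuclideanSpace.dist_eq, Real.sqrt_lt' hη]
  calc ∑ i, dist (x i) (y i) ^ 2 ≤ ∑ _i : Fin n, (η / (n + 1)) ^ 2 := by
        refine Finset.sum_le_sum fun i _ => ?_
        rw [dist_eq_norm]
        exact pow_le_pow_left₀ (norm_nonneg _) (h i).le 2
    _ = n / (n + 1) ^ 2 * η ^ 2 := by
        rw [Finset.sum_const, Finset.card_univ, Fintype.card_fin, nsmul_eq_mul, div_pow]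
        ring
    _ < 1 * η ^ 2 := by
        refine mul_lt_mul_of_pos_right ?_ (by positivity)
        rw [div_lt_one (by positivity)]
        nlinarith [(Nat.cast_nonneg n : (0 : ℝ) ≤ n)]
    _ = η ^ 2 := one_mul _

/-- A connected open set contains a polynomial arc that passes close to given points and has
prescribed orders of contact at its origin. -/
theorem exists_polyCurve {n m : ℕ} {Ω : Set (Aff n)} (hΩ : IsOpen Ω) (hconn : IsConnected Ω)
    {q : Fin (m + 1) → Aff n} (hq : ∀ i, q i ∈ Ω) {δ : ℝ} (hδ : 0 < δ) (a : Fin n → ℕ) :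
    ∃ (c : Fin n → ℂ) (Q : Fin n → Polynomial ℂ), (∀ i, (Q i).eval 0 ≠ 0) ∧
      (∀ x ∈ Set.Icc (0 : ℝ) 1, polyCurve c a Q x ∈ Ω) ∧
      ∀ i, ∃ x ∈ Set.Icc (0 : ℝ) 1, dist (polyCurve c a Q x) (q i) < δ := by
  obtain ⟨σ, hσ, hqσ⟩ :=
    (hΩ.isConnected_iff_isPathConnected.1 hconn).exists_path_through_family q hq
  obtain ⟨ε, hε, hεΩ⟩ := (isCompact_range σ.continuous).exists_thickening_subset_open hΩ hσ
  -- `τ` rests at `q 0` on `[0, 1/2]` and then runs through `σ`. The rest makes `(τ - q 0) / x ^ a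
  -- i` extend continuously by zero near `0`, with `max x (1 / 2)` as denominator; multiplying an
  -- approximation back by `x ^ a i ≤ 1` does not increase the error.
  let τ : ℝ → Aff n := fun x => σ.extend (2 * x - 1)
  have hτ : Continuous τ := σ.continuous_extend.comp (by fun_prop)
  have hη : 0 < min ε δ := lt_min hε hδ
  have hpos : ∀ x : ℝ, 0 < max x (1 / 2) := fun x => lt_max_of_lt_right (by norm_num)
  have happrox : ∀ i, ∃ Q : Polynomial ℂ, Q.eval 0 ≠ 0 ∧ ∀ x ∈ Set.Icc (0 : ℝ) 1,
      ‖Q.eval (x : ℂ) - (τ x i - q 0 i) / ((max x (1 / 2) : ℝ) : ℂ) ^ a i‖ <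
        min ε δ / (n + 1) := by
    intro i
    refine exists_polynomial_near_eval_zero_ne_zero ?_ (by positivity)
    refine Continuous.div ?_ ?_ fun x => pow_ne_zero _ (Complex.ofReal_ne_zero.2 (hpos x).ne')
    · exact ((EuclideanSpace.proj (𝕜 := ℂ) i).continuous.comp hτ).sub continuous_const
    · fun_prop
  choose Q hQ0 hQ using happrox
  have hclose : ∀ x ∈ Set.Icc (0 : ℝ) 1,
      dist (polyCurve (fun i => q 0 i) a Q x) (τ x) < min ε δ := by
    intro x hx
    refine dist_lt_of_forall_norm_lt hη fun i => ?_
    have hfac : (x : ℂ) ^ a i * ((τ x i - q 0 i) / ((max x (1 / 2) : ℝ) : ℂ) ^ a i) =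
        τ x i - q 0 i := by
      rcases le_total x (1 / 2) with hx2 | hx2
      · have : τ x = q 0 := σ.extend_of_le_zero (by linarith)
        simp [this]
      · rw [max_eq_left hx2]
        have : (x : ℂ) ≠ 0 := Complex.ofReal_ne_zero.2 (by linarith)
        field_simp
    have hdiff : polyCurve (fun i => q 0 i) a Q x i - τ x i = (x : ℂ) ^ a i *
        ((Q i).eval (x : ℂ) - (τ x i - q 0 i) / ((max x (1 / 2) : ℝ) : ℂ) ^ a i) := by
      rw [mul_sub, hfac, polyCurve_apply]
      ring
    rw [hdiff, norm_mul, norm_pow, Complex.norm_real, Real.norm_of_nonneg hx.1]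
    exact (mul_le_of_le_one_left (norm_nonneg _) (pow_le_one₀ hx.1 hx.2)).trans_lt (hQ i x hx)
  refine ⟨fun i => q 0 i, Q, hQ0, fun x hx => hεΩ ?_, fun i => ?_⟩
  · refine Metric.mem_thickening_iff.2 ⟨τ x, ?_, (hclose x hx).trans_le (min_le_left _ _)⟩
    rw [← σ.extend_range]
    exact ⟨_, rfl⟩
  · obtain ⟨y, hy⟩ := hqσ i
    have hx : ((y : ℝ) + 1) / 2 ∈ Set.Icc (0 : ℝ) 1 :=
      ⟨by linarith [y.2.1], by linarith [y.2.2]⟩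
    refine ⟨_, hx, ?_⟩
    have hτy : τ (((y : ℝ) + 1) / 2) = q i := by
      simp only [τ]
      rw [show 2 * (((y : ℝ) + 1) / 2) - 1 = y by ring, Path.extend_apply, ← hy]
    rw [← hτy]
    exact (hclose _ hx).trans_le (min_le_right _ _)

/-! ### Dimension count along the curve. -/

theorem sum_norm_sq_homogeneous {N : ℕ} (z : Aff N) :
    ∑ i, ‖homogeneous z i‖ ^ 2 = 1 + ‖z‖ ^ 2 := by
  simp [homogeneous, Fin.sum_univ_succ, EuclideanSpace.norm_sq_eq]

theorem differentiableOn_homogeneous {N : ℕ} {g : ℂ → Aff N} {U : Set ℂ}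
    (hg : DifferentiableOn ℂ g U) (j : Fin (N + 1)) :
    DifferentiableOn ℂ (fun t => homogeneous (g t) j) U := by
  refine Fin.cases ?_ (fun j => ?_) j
  · exact differentiableOn_const 1
  · exact differentiableOn_euclidean.1 hg j

theorem jet_one : jet (fun _ => 1) = 1 := by
  ext k
  rw [coeff_jet, iteratedDeriv_const, PowerSeries.coeff_one]
  split_ifs with hk
  · simp [hk]
  · simp

theorem order_jet_id : (jet fun t => t).order = 1 := by
  refine PowerSeries.order_eq_nat.2 ⟨?_, fun k hk => ?_⟩
  · simp [coeff_jet, iteratedDeriv_fun_id_zero]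
  · obtain rfl : k = 0 := by omega
    simp [coeff_jet]

theorem order_jet_pow (a : ℕ) : (jet fun t => t ^ a).order = a := by
  induction a with
  | zero => simp [jet_one]
  | succ a ih =>
    simp only [pow_succ]
    rw [jet_mul (f := fun t => t ^ a) (g := fun t => t) (analyticAt_id.pow a) analyticAt_id,
      PowerSeries.order_mul, ih, order_jet_id, Nat.cast_succ]

theorem order_jet_eq_zero {f : ℂ → ℂ} (hf : f 0 ≠ 0) : (jet f).order = 0 := by
  refine PowerSeries.order_eq_nat.2 ⟨?_, fun k hk => absurd hk (Nat.not_lt_zero k)⟩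
  simpa [coeff_jet] using hf

/-- Orders realised by the span of the homogeneous coordinates of a polynomial curve. -/
theorem exists_order_eq_polyCurve {n : ℕ} (c : Fin n → ℂ) (a : Fin n → ℕ)
    {Q : Fin n → Polynomial ℂ} (hQ : ∀ i, (Q i).eval 0 ≠ 0) (i : Fin (n + 1)) :
    ∃ v ∈ Submodule.span ℂ (Set.range fun i => jet fun t => homogeneous (polyCurve c a Q t) i),
      v.order = (Fin.cons 0 a : Fin (n + 1) → ℕ) i := by
  have hmem : ∀ i, (jet fun t => homogeneous (polyCurve c a Q t) i) ∈
      Submodule.span ℂ (Set.range fun i => jet fun t => homogeneous (polyCurve c a Q t) i) :=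
    fun i => Submodule.subset_span ⟨i, rfl⟩
  have han : ∀ i, AnalyticAt ℂ (fun t => homogeneous (polyCurve c a Q t) i) 0 := fun i =>
    (differentiableOn_homogeneous (differentiable_polyCurve c a Q).differentiableOn i).analyticAt
      Filter.univ_mem
  refine Fin.cases ?_ (fun i => ?_) i
  · exact ⟨_, hmem 0, order_jet_eq_zero (f := fun _ => 1) one_ne_zero⟩
  · have hfun : (fun t : ℂ => t ^ a i * (Q i).eval t) = fun t =>
        ∑ j, (Fin.cons (-c i) (Pi.single i 1) : Fin (n + 1) → ℂ) j *
          homogeneous (polyCurve c a Q t) j := by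
      funext t
      simp [Fin.sum_univ_succ, homogeneous, polyCurve_apply, Pi.single_apply]
    refine ⟨jet fun t : ℂ => t ^ a i * (Q i).eval t, ?_, ?_⟩
    · rw [hfun, jet_sum_mul _ han]
      exact Submodule.sum_mem _ fun j _ => Submodule.smul_mem _ _ (hmem j)
    · rw [jet_mul (f := fun t => t ^ a i) (g := fun t => (Q i).eval t) (analyticAt_id.pow _)
        ((Q i).differentiable.analyticAt 0), PowerSeries.order_mul, order_jet_pow,
        order_jet_eq_zero (hQ i), add_zero, Fin.cons_succ]

/-- Germs at the origin of the homogeneous coordinates of a map stay independent along a curve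
through points at which these coordinates are independent. -/
theorem linearIndependent_jet_homogeneous {m : ℕ} {g : ℂ → Aff m} {D : Set ℂ} (hD : IsOpen D)
    (hD' : IsPreconnected D) (h0 : (0 : ℂ) ∈ D) (hg : DifferentiableOn ℂ g D) {x : Fin (m + 1) → ℂ}
    (hx : ∀ i, x i ∈ D) (hli : LinearIndependent ℂ fun i => homogeneous (g (x i))) :
    LinearIndependent ℂ fun j => jet fun t => homogeneous (g t) j := by
  have hB := differentiableOn_homogeneous hg
  rw [Fintype.linearIndependent_iff]
  intro w hw
  rw [← jet_sum_mul w fun j => (hB j).analyticAt (hD.mem_nhds h0)] at hw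
  have hz := eqOn_zero_of_jet_eq_zero hD hD' h0
    (DifferentiableOn.fun_sum fun j _ => (hB j).const_mul (w j)) hw
  -- The relation `w` holds on all of `D`, in particular at the points `x i`, where the matrix of
  -- coordinates is invertible.
  let M : Matrix (Fin (m + 1)) (Fin (m + 1)) ℂ := Matrix.of fun i => homogeneous (g (x i))
  have hM : IsUnit M := Matrix.linearIndependent_rows_iff_isUnit.1 hli
  have hMw : M *ᵥ w = M *ᵥ 0 := by
    rw [Matrix.mulVec_zero]
    funext i
    refine Eq.trans ?_ (hz (hx i))
    simp [Matrix.mulVec, dotProduct, M, mul_comm]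
  exact congrFun (Matrix.mulVec_injective_of_isUnit hM hMw)

/-- Dimension count for a map whose Fubini–Study form is a `1`-modification: along a suitable
curve, the homogeneous coordinates of `h` span a space of germs of the same dimension as a product
`V * W`, where `V` is spanned by `1, z₁, …, zₙ`. -/
theorem exists_dimension_bounds {n m d : ℕ} {Ω : Set (Aff n)} (hΩ : IsOpen Ω)
    (hconn : IsConnected Ω) {h : Aff n → Aff m} (hh : DifferentiableOn ℂ h Ω)
    (hmin : MinimallyEmbedded Ω h) {f : Aff n → Aff d} (hf : DifferentiableOn ℂ f Ω)
    (heq : Set.EqOn (pullback h (fubiniStudy m)) (oneModification f) Ω) :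
    ∃ R : ℕ, m + 1 ≤ (n + 1) * R ∧ ∀ r ≤ R, r * (n + 1) ≤ m + 1 + r.choose 2 := by
  obtain ⟨q, hq, hli⟩ := hmin.exists_linearIndependent
  obtain ⟨δ, hδ, hδli⟩ := exists_forall_dist_lt_linearIndependent hΩ hh.continuousOn hq hli
  let a : Fin n → ℕ := fun i => 3 ^ (i : ℕ)
  obtain ⟨c, Q, hQ, hγΩ, hγq⟩ := exists_polyCurve hΩ hconn hq hδ a
  set γ := polyCurve c a Q
  have hγ : Differentiable ℂ γ := differentiable_polyCurve c a Q
  choose x hx hxq using hγq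
  -- A convex neighbourhood of the segment carries the identity theorem from the origin to the
  -- points `x i`; the norm identity is needed only on a disc about the origin.
  set S : Set ℂ := Complex.ofRealCLM '' Set.Icc (0 : ℝ) 1
  have hScomp : IsCompact S := isCompact_Icc.image Complex.ofRealCLM.continuous
  have hSconv : Convex ℝ S := (convex_Icc 0 1).linear_image Complex.ofRealCLM.toLinearMap
  have h0S : (0 : ℂ) ∈ S := ⟨0, by simp, by simp⟩
  obtain ⟨ρ, hρ, hρΩ⟩ := hScomp.exists_thickening_subset_open (hΩ.preimage hγ.continuous)
    (by rintro _ ⟨y, hy, rfl⟩; exact hγΩ y hy)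
  have hballΩ : Set.MapsTo γ (Metric.ball 0 ρ) Ω := fun t ht =>
    hρΩ (Metric.ball_subset_thickening h0S ρ ht)
  have hball : IsOpen (Metric.ball (0 : ℂ) ρ) := Metric.isOpen_ball
  have h0ball : (0 : ℂ) ∈ Metric.ball (0 : ℂ) ρ := Metric.mem_ball_self hρ
  have hhγ : DifferentiableOn ℂ (h ∘ γ) (Metric.ball 0 ρ) :=
    hh.comp hγ.differentiableOn hballΩ
  have hfγ : DifferentiableOn ℂ (f ∘ γ) (Metric.ball 0 ρ) :=
    hf.comp hγ.differentiableOn hballΩ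
  have hjets : LinearIndependent ℂ fun j => jet fun t => homogeneous ((h ∘ γ) t) j :=
    linearIndependent_jet_homogeneous Metric.isOpen_thickening
      (hSconv.thickening ρ).isPreconnected (Metric.self_subset_thickening hρ S h0S)
      (hh.comp hγ.differentiableOn hρΩ) (x := fun i => (x i : ℂ))
      (fun i => Metric.self_subset_thickening hρ S ⟨x i, hx i, rfl⟩) (hδli _ hxq)
  obtain ⟨G, hG, hGeq⟩ := exists_norm_sq_mul_eq hhγ hγ.differentiableOn hfγ fun t ht =>
    leviForm_comp_eq hΩ hh hf heq (hγ t) (hballΩ ht)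
  let Z : Fin (n + 1) → ℂ → ℂ := fun i t => homogeneous (γ t) i
  -- Absorbing `G` here makes `1 + ‖hγ‖²` the sum of the squared moduli of the products `Z i * F j`.
  let F : Fin (d + 1) → ℂ → ℂ := fun j t => G t * homogeneous ((f ∘ γ) t) j
  have hZ : ∀ i, DifferentiableOn ℂ (Z i) (Metric.ball 0 ρ) :=
    differentiableOn_homogeneous hγ.differentiableOn
  have hF : ∀ j, DifferentiableOn ℂ (F j) (Metric.ball 0 ρ) := fun j =>
    hG.mul (differentiableOn_homogeneous hfγ j)
  let V := Submodule.span ℂ (Set.range fun i => jet (Z i))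
  let W := Submodule.span ℂ (Set.range fun j => jet (F j))
  have : FiniteDimensional ℂ V := FiniteDimensional.span_of_finite ℂ (Set.finite_range _)
  have : FiniteDimensional ℂ W := FiniteDimensional.span_of_finite ℂ (Set.finite_range _)
  have hVW : V * W = Submodule.span ℂ
      (Set.range fun p : Fin (n + 1) × Fin (d + 1) => jet fun t => Z p.1 t * F p.2 t) := by
    rw [Submodule.span_mul_span]
    congr 1
    ext y
    simp [Set.mem_mul, jet_mul ((hZ _).analyticAt (hball.mem_nhds h0ball))
      ((hF _).analyticAt (hball.mem_nhds h0ball))]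
  have hfin : Module.finrank ℂ ↥(V * W) = m + 1 := by
    rw [hVW, finrank_span_jet_eq hball h0ball
      (A := fun (p : Fin (n + 1) × Fin (d + 1)) t => Z p.1 t * F p.2 t)
      (fun p => (hZ p.1).mul (hF p.2))
      (differentiableOn_homogeneous hhγ) ?_, finrank_span_eq_card hjets, Fintype.card_fin]
    intro t ht
    rw [sum_norm_sq_homogeneous, hGeq t ht, Fintype.sum_prod_type]
    simp only [Z, F, norm_mul, mul_pow, ← Finset.mul_sum, sum_norm_sq_homogeneous, ← Finset.sum_mul]
    ring
  refine ⟨Module.finrank ℂ W, ?_, fun r hr => ?_⟩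
  · rw [← hfin]
    simpa using finrank_span_mul_le (fun i => jet (Z i)) W
  · let e : Fin (n + 1) → ℕ := Fin.cons 0 a
    have he : ∀ i, e i = 0 ∨ ∃ k : ℕ, e i = 3 ^ k := fun i =>
      Fin.cases (Or.inl rfl) (fun i => Or.inr ⟨i, rfl⟩) i
    have hinj : Function.Injective e := by
      refine Fin.cons_injective_iff.2 ⟨?_, fun i j hij => ?_⟩
      · rintro ⟨i, hi⟩
        exact absurd hi (pow_ne_zero _ (by norm_num))
      · exact Fin.ext (Nat.pow_right_injective (le_refl 2 |>.trans (by norm_num)) hij)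
    have hcard : (Finset.univ.image e).card = n + 1 := by
      rw [Finset.card_image_of_injective _ hinj, Finset.card_univ, Fintype.card_fin]
    have he' : ∀ b ∈ Finset.univ.image e, b = 0 ∨ ∃ k : ℕ, b = 3 ^ k := by
      intro b hb
      obtain ⟨i, -, rfl⟩ := Finset.mem_image.1 hb
      exact he i
    have hmul := mul_card_le_finrank_mul V W (E := Finset.univ.image e)
      (fun a ha b hb c hc d hd habcd =>
        zero_or_pow_three_sidon (he' a ha) (he' b hb) (he' c hc) (he' d hd) habcd)
      (by
        intro b hb
        obtain ⟨i, -, rfl⟩ := Finset.mem_image.1 hb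
        exact exists_order_eq_polyCurve c a hQ i) r hr
    rwa [hcard, hfin] at hmul

end FubiniStudyGap

/-! ### The numerical contradiction. -/

theorem corollary2 (n m : ℕ) (Ω : Set (FubiniStudyGap.Aff n)) (hΩ : IsOpen Ω)
    (hconn : IsConnected Ω)
    (h : FubiniStudyGap.Aff n → FubiniStudyGap.Aff m) (hh : DifferentiableOn ℂ h Ω)
    (hmin : FubiniStudyGap.MinimallyEmbedded Ω h)
    (k : ℤ) (hlow : (n : ℚ) * (k + 1) + k < m)
    (hupp : (m : ℚ) < n * (k + 2) - k * (k + 1) / 2) :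
    ∀ (d : ℕ) (f : FubiniStudyGap.Aff n → FubiniStudyGap.Aff d), DifferentiableOn ℂ f Ω →
      ¬ Set.EqOn (FubiniStudyGap.pullback h (FubiniStudyGap.fubiniStudy m))
          (FubiniStudyGap.oneModification f) Ω := by
  intro d f hf heq
  obtain ⟨R, hR, hbound⟩ :=
    FubiniStudyGap.exists_dimension_bounds hΩ hconn hh hmin hf heq
  have hn : (0 : ℚ) ≤ n := Nat.cast_nonneg n
  have hm : (0 : ℚ) ≤ m := Nat.cast_nonneg m
  -- For `k ≤ -2` the upper bound on `m` is negative.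
  have hk : -1 ≤ k := by
    by_contra hk
    have hk2 : (k : ℚ) ≤ -2 := by exact_mod_cast (show k ≤ -2 by omega)
    nlinarith [mul_nonneg hn (show (0 : ℚ) ≤ -(k + 2) by linarith)]
  obtain ⟨r, hr⟩ := Int.eq_ofNat_of_zero_le (show 0 ≤ k + 2 by omega)
  have hkr : (k : ℚ) = r - 2 := by
    have : ((k + 2 : ℤ) : ℚ) = ((r : ℤ) : ℚ) := congrArg _ hr
    push_cast at this
    linarith
  -- The lower bound on `m` reads `(n + 1)(k + 1) < m + 1`, and `m + 1 ≤ (n + 1) R`; hence `R ≥ k +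
  -- 2 = r`.
  have hrR : r ≤ R := by
    by_contra hlt
    have h1 : (R : ℚ) + 1 ≤ r := by exact_mod_cast (show R + 1 ≤ r by omega)
    have h2 : (m : ℚ) + 1 ≤ (n + 1) * R := by exact_mod_cast hR
    rw [hkr] at hlow
    nlinarith [mul_le_mul_of_nonneg_left h1 (show (0 : ℚ) ≤ n + 1 by linarith)]
  -- With `r = k + 2`, the number `r (n + 1) - r (r - 1) / 2 - 1` is exactly the upper bound `n (k +
  -- 2) - k (k + 1) / 2`.
  have h3 : (r : ℚ) * (n + 1) ≤ m + 1 + (r.choose 2 : ℕ) := by exact_mod_cast hbound r hrR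
  rw [Nat.cast_choose_two] at h3
  rw [hkr] at hupp
  linarith
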